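/- Let $X$ be an arbitrary topological space and let $Y$ be a metrizable, connected and locally arcwise connected space. A subset of $X$ is called functionally closed if it has the form $\varphi^{-1}(0)$ for some continuous $\varphi:X\to[0,1]$, functionally open if its complement is functionally closed, and functionally $F_\sigma$ if it is the union of a sequence of functionally closed sets. An indexed family $(U_i)_{i\in I}$ of subsets of $X$ is called discrete if every point of $X$ has an open neighborhood that meets $U_i$ for at most one index $i\in I$; a family $(A_i)_{i\in I}$ of subsets of $X$ is called strongly functionally discrete if there is a discrete family $(U_i)_{i\in I}$ of functionally open subsets of $X$ with $\overline{A_i}\subseteq U_i$ for every $i\in I$. Denote by - ${\rm B}_1(X,Y)$ the set of all maps $f:X\to Y$ that are pointwise limits of a sequence of continuous maps $X\to Y$; - ${\rm K}_1(X,Y)$ the set of all maps $f:X\to Y$ such that $f^{-1}(V)$ is functionally $F_\sigma$ in $X$ for every open $V\subseteq Y$; - $\Sigma^f(X,Y)$ the set of all maps $f:X\to Y$ for which there is a family $\mathcal B=\bigcup_{n=1}^\infty\mathcal B_n$ of subsets of $X$ such that each $\mathcal B_n$ is strongly functionally discrete and, for every open $V\subseteq Y$, the set $f^{-1}(V)$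 is a union of members of $\mathcal B$. Then $$ {\rm B}_1(X,Y)={\rm K}_1(X,Y)\cap\Sigma^f(X,Y). $$ -/

import Mathlib

open Set Filter Topology

/-- A set is functionally closed if it is the zero set of a continuous function `X → [0,1]`. -/
def FunctionallyClosed {X : Type*} [TopologicalSpace X] (A : Set X) : Prop :=
  ∃ φ : X → unitInterval, Continuous φ ∧ A = φ ⁻¹' {0}

/-- A set is functionally open if its complement is functionally closed. -/
def FunctionallyOpen {X : Type*} [TopologicalSpace X] (A : Set X) : Prop :=
  FunctionallyClosed Aᶜ

/-- A functionally `F_σ` set: the union of a sequence of functionally closed sets. -/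
def FunctionallyFSigma {X : Type*} [TopologicalSpace X] (A : Set X) : Prop :=
  ∃ F : ℕ → Set X, (∀ n, FunctionallyClosed (F n)) ∧ A = ⋃ n, F n

/-- An indexed family of sets is discrete if every point has an open neighborhood that meets
`A i` for at most one index `i`. -/
def DiscreteFamily {X ι : Type*} [TopologicalSpace X] (A : ι → Set X) : Prop :=
  ∀ x : X, ∃ W : Set X, IsOpen W ∧ x ∈ W ∧ {i : ι | (W ∩ A i).Nonempty}.Subsingleton

/-- An indexed family `A` is strongly functionally discrete if there is a discrete family `U` of
functionally open sets, with the same index set, such that `closure (A i) ⊆ U i` for all `i`. -/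
def StronglyFunctionallyDiscrete {X ι : Type*} [TopologicalSpace X] (A : ι → Set X) : Prop :=
  ∃ U : ι → Set X, DiscreteFamily U ∧ (∀ i, FunctionallyOpen (U i)) ∧ ∀ i, closure (A i) ⊆ U i

/-- A family of sets is `σ`-strongly functionally discrete if it is the union of a sequence of
strongly functionally discrete families (each of them indexed by its own members). -/
def SigmaStronglyFunctionallyDiscrete {X : Type*} [TopologicalSpace X] (B : Set (Set X)) : Prop :=
  ∃ A : ℕ → Set (Set X), B = ⋃ n, A n ∧
    ∀ n, StronglyFunctionallyDiscrete (fun S : A n => (S : Set X))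

/-- A family `B` of subsets of `X` is a base for the mapping `f : X → Y` if the preimage of every
open subset of `Y` is a union of members of `B`. -/
def IsBaseForMap {X Y : Type*} [TopologicalSpace Y] (B : Set (Set X)) (f : X → Y) : Prop :=
  ∀ V : Set Y, IsOpen V → ∃ C : Set (Set X), C ⊆ B ∧ f ⁻¹' V = ⋃₀ C

/-- The first Baire class `B₁(X,Y)`: pointwise limits of sequences of continuous mappings. -/
def BaireOneClass (X Y : Type*) [TopologicalSpace X] [TopologicalSpace Y] : Set (X → Y) :=
  {f | ∃ g : ℕ → X → Y, (∀ n, Continuous (g n)) ∧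
    ∀ x, Tendsto (fun n => g n x) atTop (𝓝 (f x))}

/-- The first functional Lebesgue class `K₁(X,Y)`: preimages of open sets are functionally
`F_σ`. -/
def FunctionalLebesgueOneClass (X Y : Type*) [TopologicalSpace X] [TopologicalSpace Y] :
    Set (X → Y) :=
  {f | ∀ V : Set Y, IsOpen V → FunctionallyFSigma (f ⁻¹' V)}

/-- The class `Σᶠ(X,Y)` of `σ`-strongly functionally discrete mappings: those having a
`σ`-strongly functionally discrete base. -/
def SigmaSFDClass (X Y : Type*) [TopologicalSpace X] [TopologicalSpace Y] : Set (X → Y) :=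
  {f | ∃ B : Set (Set X), SigmaStronglyFunctionallyDiscrete B ∧ IsBaseForMap B f}

/-! ### Discrete families and gluing of continuous maps along nested bumps. -/

section Discrete

variable {X Y ι κ : Type*} [TopologicalSpace X] [TopologicalSpace Y]

/-! If `g n → f` pointwise with `g n` continuous, then for closed `C ⊆ Y` the set of `x` with `g n x
∈ C` for all `n ≥ m` is functionally closed, and `f` maps it into `C`. Closed sets exhausting an
open set give `K₁` (`lebesgueOne_of_baireOne`). Stone's σ-discrete refinements of covers by small
balls give `Σᶠ`, since the preimage under `g m` of a discrete family is discrete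
(`sigma_of_baireOne`).

Conversely, over any path connected open `V`, a base as in `Σᶠ` cut down by `K₁` gives countably
many discrete families of bumps, equal to 1 only at points that `f` sends into small path connected
open subsets of `V` (`exists_bumps_over`). For each `n`, `exists_disjointed_bumps` merges them into
one discrete family, at the price that a point is covered only for large `n`. Iteration yields a
tree of nested open sets with nested bumps. The `n`-th bumps, down to depth `n`, are realised by a
continuous map that moves along paths from node to node (`exists_continuous_of_tower`). At every
depth `p`, some node within `1/p` of `f x` has bump 1 at `x` for all large `n`, so these maps
converge to `f`. -/

theorem DiscreteFamily.comp_injective {A : ι → Set X} (hA : DiscreteFamily A) {σ : κ → ι}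
    (hσ : Function.Injective σ) : DiscreteFamily (A ∘ σ) := by
  intro x
  obtain ⟨W, hW, hx, hs⟩ := hA x
  exact ⟨W, hW, hx, fun i hi j hj => hσ (hs hi hj)⟩

theorem DiscreteFamily.eq_of_mem {A : ι → Set X} (hA : DiscreteFamily A) {x : X} {i j : ι}
    (hi : x ∈ A i) (hj : x ∈ A j) : i = j := by
  obtain ⟨W, -, hx, hs⟩ := hA x
  exact hs ⟨x, hx, hi⟩ ⟨x, hx, hj⟩

theorem DiscreteFamily.locallyFinite {A : ι → Set X} (hA : DiscreteFamily A) :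
    LocallyFinite A := by
  intro x
  obtain ⟨W, hW, hx, hs⟩ := hA x
  refine ⟨W, hW.mem_nhds hx, Subsingleton.finite fun i hi j hj => hs ?_ ?_⟩
  · rwa [mem_ofPred_eq, inter_comm]
  · rwa [mem_ofPred_eq, inter_comm]

/-- Reindexing a strongly functionally discrete family by its own members. -/
theorem StronglyFunctionallyDiscrete.range {A : ι → Set X} (hA : StronglyFunctionallyDiscrete A) :
    StronglyFunctionallyDiscrete (fun S : Set.range A => (S : Set X)) := by
  obtain ⟨U, hU, hUo, hAU⟩ := hA
  choose σ hσ using fun S : Set.range A => S.2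
  refine ⟨U ∘ σ, hU.comp_injective fun S T h => ?_, fun S => hUo _, fun S => ?_⟩
  · exact Subtype.ext (by rw [← hσ S, ← hσ T, h])
  · exact (congrArg closure (hσ S)).symm.subset.trans (hAU _)

/-- Modifying a continuous map along a discrete family of supports. -/
theorem exists_continuous_glue {φ : ι → X → ℝ} (hφ : ∀ i, Continuous (φ i))
    (hd : DiscreteFamily fun i => {x | φ i x ≠ 0}) {g : X → Y} (hg : Continuous g)
    {k : ι → X → Y} (hk : ∀ i, Continuous (k i)) {Z : ι → Set X} (hZ : ∀ i, IsClosed (Z i))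
    (hφZ : ∀ i x, φ i x ≠ 0 → x ∈ Z i) (hkg : ∀ i, ∀ x ∈ Z i, φ i x = 0 → k i x = g x) :
    ∃ g' : X → Y, Continuous g' ∧ (∀ i x, φ i x ≠ 0 → g' x = k i x) ∧
      ∀ x, (∀ i, φ i x = 0) → g' x = g x := by
  classical
  set g' : X → Y := fun x => if h : ∃ i, φ i x ≠ 0 then k h.choose x else g x with hg'
  have h1 : ∀ i x, φ i x ≠ 0 → g' x = k i x := by
    intro i x hi
    have h : ∃ i, φ i x ≠ 0 := ⟨i, hi⟩
    simp only [hg', dif_pos h]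
    rw [hd.eq_of_mem (x := x) h.choose_spec hi]
  have h2 : ∀ x, (∀ i, φ i x = 0) → g' x = g x := by
    intro x hx
    simp [hg', hx]
  -- Near `x` at most one index `i` is active, and the closed sets `Z i` and `{φ i = 0}` cover the
  -- space, so pasting two pieces suffices.
  refine ⟨g', continuous_iff_continuousAt.2 fun x => ?_, h1, h2⟩
  obtain ⟨W, hW, hxW, hs⟩ := hd x
  by_cases hne : ∃ i, (W ∩ {x | φ i x ≠ 0}).Nonempty
  · obtain ⟨i, hi⟩ := hne
    have hzero : ∀ z ∈ W, ∀ j, j ≠ i → φ j z = 0 := by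
      intro z hz j hj
      by_contra hne
      exact hj (hs ⟨z, hz, hne⟩ hi)
    have c1 : ContinuousOn (fun z => if φ i z ≠ 0 then k i z else g z) (Z i) :=
      (hk i).continuousOn.congr fun z hz => by
        by_cases h0 : φ i z = 0
        · simp [h0, hkg i z hz h0]
        · simp [h0]
    have c2 : ContinuousOn (fun z => if φ i z ≠ 0 then k i z else g z) {z | φ i z = 0} :=
      hg.continuousOn.congr fun z hz => by
        have h0 : φ i z = 0 := hz
        simp [h0]
    have hcl : IsClosed {z | φ i z = 0} := isClosed_eq (hφ i) continuous_const
    have c3 := c1.union_of_isClosed c2 (hZ i) hcl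
    have hu : Z i ∪ {z | φ i z = 0} = univ := by
      refine eq_univ_of_forall fun z => ?_
      by_cases h0 : φ i z = 0
      · exact Or.inr h0
      · exact Or.inl (hφZ i z h0)
    rw [hu, continuousOn_univ] at c3
    refine c3.continuousAt.congr (eventuallyEq_of_mem (hW.mem_nhds hxW) fun z hz => ?_)
    by_cases h0 : φ i z = 0
    · rw [h2 z fun j => ?_]
      · simp [h0]
      · by_cases hj : j = i
        · rwa [hj]
        · exact hzero z hz j hj
    · simp [h0, h1 i z h0]
  · refine hg.continuousAt.congr (eventuallyEq_of_mem (hW.mem_nhds hxW) fun z hz => ?_)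
    refine (h2 z fun j => ?_).symm
    by_contra h0
    exact hne ⟨j, z, hz, h0⟩

/-- The nodes active at a point form a single branch: an active child forces its parent to be
active, and discreteness allows one active node per level. -/
theorem suffix_of_ne_zero {φ : List ι → X → ℝ}
    (hnest : ∀ c l x, φ (c :: l) x ≠ 0 → 1 / 2 ≤ φ l x)
    (hd : ∀ p : ℕ, DiscreteFamily fun l : {l : List ι // l.length = p} => {x | φ l x ≠ 0})
    {x : X} {l : List ι} (hl : φ l x ≠ 0) :
    ∀ l' : List ι, φ l' x ≠ 0 → l.length ≤ l'.length → l <:+ l' := by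
  intro l'
  induction l' with
  | nil =>
    intro _ h
    have : l = [] := List.length_eq_zero_iff.1 (by simpa using h)
    simp [this]
  | cons c l' ih =>
    intro h hlen
    rcases hlen.eq_or_lt with he | hlt
    · have := (hd _).eq_of_mem (x := x) (i := ⟨l, he⟩) (j := ⟨c :: l', rfl⟩) hl h
      simp only [Subtype.mk.injEq] at this
      rw [this]
    · have h0 : φ l' x ≠ 0 := by
        have := hnest c l' x h
        intro h1
        norm_num [h1] at this
      exact (ih h0 (by simpa [Nat.lt_succ_iff] using hlt)).trans (List.suffix_cons c l')

theorem subset_of_suffix {ι Y : Type*} {V : List ι → Set Y} (hV : ∀ c l, V (c :: l) ⊆ V l) {l : List ι} :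
    ∀ l' : List ι, l <:+ l' → V l' ⊆ V l := by
  intro l'
  induction l' with
  | nil =>
    intro h
    rw [List.suffix_nil.1 h]
  | cons c l' ih =>
    intro h
    rcases List.suffix_cons_iff.1 h with h | h
    · rw [h]
    · exact (hV c l').trans (ih h)

/-- Given a finite tower of nested bump functions with discrete supports, and a nested tower of
path connected sets, there is a continuous map sending the tops of the bumps to the corresponding
sets. -/
theorem exists_continuous_of_tower {φ : List ι → X → ℝ} {V : List ι → Set Y}
    (hV : ∀ l, IsPathConnected (V l)) (hVn : ∀ c l, V (c :: l) ⊆ V l)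
    (hφ : ∀ l, Continuous (φ l)) (hnest : ∀ c l x, φ (c :: l) x ≠ 0 → 1 / 2 ≤ φ l x)
    (hd : ∀ p : ℕ, DiscreteFamily fun l : {l : List ι // l.length = p} => {x | φ l x ≠ 0})
    (p : ℕ) :
    ∃ g : X → Y, Continuous g ∧ ∀ l x, l.length ≤ p → 1 / 2 ≤ φ l x → g x ∈ V l := by
  choose y hy using fun l => (hV l).nonempty
  -- The exact value `y l` on the deepest level gives the next level's paths a fixed starting point.
  suffices H : ∃ g : X → Y, Continuous g ∧
      (∀ l x, l.length ≤ p → 1 / 2 ≤ φ l x → g x ∈ V l) ∧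
      ∀ l x, l.length = p → 1 / 2 ≤ φ l x → g x = y l by
    obtain ⟨g, h1, h2, -⟩ := H
    exact ⟨g, h1, h2⟩
  induction p with
  | zero =>
    refine ⟨fun _ => y [], continuous_const, fun l x hl _ => ?_, fun l x hl _ => ?_⟩
    · rw [List.length_eq_zero_iff.1 (Nat.le_zero.1 hl)]
      exact hy _
    · rw [List.length_eq_zero_iff.1 hl]
  | succ p ih =>
    obtain ⟨g, hg, hgV, hgy⟩ := ih
    have hJ : ∀ c l, JoinedIn (V l) (y l) (y (c :: l)) := fun c l =>
      (hV l).joinedIn _ (hy l) _ (hVn c l (hy _))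
    choose γ hγ using hJ
    have hlen : ∀ l : {l : List ι // l.length = p + 1}, ∃ c l', l.1 = c :: l' ∧ l'.length = p := by
      rintro ⟨l, hl⟩
      cases l with
      | nil => simp at hl
      | cons c l' => exact ⟨c, l', rfl, by simpa using hl⟩
    choose hd' tl hcons htl using hlen
    obtain ⟨g', hg', hk, hz⟩ := exists_continuous_glue (φ := fun l => φ l.1)
      (fun l => hφ l.1) (hd (p + 1)) hg
      -- The path starts at the old value where the bump vanishes; the factor 2 makes it finish once
      -- the bump reaches `1/2`.
      (k := fun l x => (γ (hd' l) (tl l)).extend (2 * φ l.1 x))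
      (fun l => (γ _ _).continuous_extend.comp (continuous_const.mul (hφ _)))
      (Z := fun l => {x | 1 / 2 ≤ φ (tl l) x})
      (fun l => isClosed_le continuous_const (hφ _))
      (fun l x h => hnest (hd' l) (tl l) x (by rw [← hcons]; exact h))
      (fun l x hx h => by
        simp only [h, mul_zero, Path.extend_zero]
        exact (hgy _ x (htl l) hx).symm)
    refine ⟨g', hg', fun l x hl h => ?_, fun l x hl h => ?_⟩
    · have hl0 : φ l x ≠ 0 := fun h0 => by norm_num [h0] at h
      by_cases hx : ∃ l' : {l : List ι // l.length = p + 1}, φ l'.1 x ≠ 0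
      · obtain ⟨l', hl'⟩ := hx
        rw [hk l' x hl']
        rcases hl.eq_or_lt with he | hlt
        · have : (⟨l, he⟩ : {l : List ι // l.length = p + 1}) = l' :=
            (hd (p + 1)).eq_of_mem (x := x) hl0 hl'
          subst this
          dsimp only
          rw [Path.extend_of_one_le _ (by linarith), ← hcons]
          exact hy _
        · have h0 : φ (tl l') x ≠ 0 := fun h0 => by
            have := hnest (hd' l') (tl l') x (by rw [← hcons]; exact hl')
            norm_num [h0] at this
          refine subset_of_suffix hVn _ (suffix_of_ne_zero hnest hd hl0 (tl l') h0 ?_) ?_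
          · rw [htl]; omega
          · exact hγ _ _ _
      · push Not at hx
        rw [hz x hx]
        rcases hl.eq_or_lt with he | hlt
        · exact absurd (hx ⟨l, he⟩) hl0
        · exact hgV l x (by omega) h
    · have hl0 : φ l x ≠ 0 := fun h0 => by norm_num [h0] at h
      rw [hk ⟨l, hl⟩ x hl0, Path.extend_of_one_le _ (by dsimp only; linarith), ← hcons]

end Discrete

/-! ### Construction of bump functions from the two hypotheses on `f`. -/

section Bumps

variable {X ι : Type*} [TopologicalSpace X]

theorem FunctionallyClosed.exists_real {A : Set X} (hA : FunctionallyClosed A) :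
    ∃ a : X → ℝ, Continuous a ∧ (∀ x, 0 ≤ a x) ∧ (∀ x, a x ≤ 1) ∧ ∀ x, a x = 0 ↔ x ∈ A := by
  obtain ⟨φ, hφ, rfl⟩ := hA
  exact ⟨fun x => φ x, continuous_subtype_val.comp hφ, fun x => (φ x).2.1, fun x => (φ x).2.2,
    fun x => ⟨fun h => Subtype.ext h, fun h => congrArg Subtype.val h⟩⟩

theorem FunctionallyOpen.exists_real {A : Set X} (hA : FunctionallyOpen A) :
    ∃ a : X → ℝ, Continuous a ∧ (∀ x, 0 ≤ a x) ∧ (∀ x, a x ≤ 1) ∧ ∀ x, a x ≠ 0 ↔ x ∈ A := by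
  obtain ⟨a, h1, h2, h3, h4⟩ := FunctionallyClosed.exists_real hA
  exact ⟨a, h1, h2, h3, fun x => by rw [Ne, h4, mem_compl_iff, not_not]⟩

/-- A sequence of families of bump functions with discrete supports can be shrunk to families whose
supports are discrete also across finitely many terms of the sequence. -/
theorem exists_disjointed_bumps {u : ℕ → ι → X → ℝ} (hu : ∀ j t, Continuous (u j t))
    (hu1 : ∀ j t x, u j t x ≤ 1)
    (hd : ∀ j, DiscreteFamily fun t => {x | u j t x ≠ 0}) :
    ∃ θ : ℕ → ℕ × ι → X → ℝ, (∀ n c, Continuous (θ n c)) ∧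
      (∀ n, DiscreteFamily fun c => {x | θ n c x ≠ 0}) ∧
      ∀ x, (∃ j t, u j t x = 1) → ∃ j t, u j t x = 1 ∧ ∀ᶠ n in atTop, θ n (j, t) x = 1 := by
  classical
  set s : ℕ → X → ℝ := fun j x => ∑ᶠ t, u j t x with hs
  have hsc : ∀ j, Continuous (s j) := fun j => continuous_finsum (hu j) (hd j).locallyFinite
  have hsu : ∀ j t x, u j t x ≠ 0 → s j x = u j t x := fun j t x h =>
    finsum_eq_single _ t fun t' ht' => by
      by_contra h'
      exact ht' ((hd j).eq_of_mem (x := x) h' h)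
  have hs1 : ∀ j x, s j x ≤ 1 := by
    intro j x
    by_cases h : ∃ t, u j t x ≠ 0
    · obtain ⟨t, ht⟩ := h
      rw [hsu j t x ht]
      exact hu1 j t x
    · push Not at h
      simp [hs, h]
  -- Family `j` lives where `(n+1)(1 - s j) < 1`, and every later family where this quantity exceeds
  -- 2. The gap separates the supports.
  set θ : ℕ → ℕ × ι → X → ℝ := fun n c x => if c.1 ≤ n then
    max 0 (1 - (n + 1) * (1 - u c.1 c.2 x)) *
      ∏ i ∈ Finset.range c.1, max 0 (min 1 ((n + 1) * (1 - s i x) - 2)) else 0 with hθ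
  have key : ∀ n j t x, θ n (j, t) x ≠ 0 → j ≤ n ∧ u j t x ≠ 0 ∧ (n + 1) * (1 - s j x) < 1 ∧
      ∀ i < j, 2 < (n + 1) * (1 - s i x) := by
    intro n j t x h
    have hjn : j ≤ n := by
      by_contra h'
      simp [hθ, h'] at h
    simp only [hθ, if_pos hjn] at h
    have h1 := left_ne_zero_of_mul h
    have h2 := right_ne_zero_of_mul h
    have h3 : 0 < 1 - ((n : ℝ) + 1) * (1 - u j t x) := by
      by_contra h'
      exact h1 (max_eq_left (not_lt.1 h'))
    have h4 : u j t x ≠ 0 := by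
      intro h0
      rw [h0] at h3
      have : (0 : ℝ) ≤ n := n.cast_nonneg
      linarith
    refine ⟨hjn, h4, by rw [hsu j t x h4]; linarith, fun i hi => ?_⟩
    have h5 := Finset.prod_ne_zero_iff.1 h2 i (Finset.mem_range.2 hi)
    by_contra h'
    refine h5 (max_eq_left ((min_le_right _ _).trans ?_))
    linarith [not_lt.1 h']
  refine ⟨θ, fun n c => ?_, fun n x => ?_, fun x hx => ?_⟩
  · by_cases h : c.1 ≤ n
    · simp only [hθ, if_pos h]
      have := hu c.1 c.2
      fun_prop
    · simp only [hθ, if_neg h]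
      exact continuous_const
  · choose W hWo hxW hWs using fun j => hd j x
    have hn : (0 : ℝ) < n + 1 := by positivity
    -- Each `(n+1) s j` varies by less than 1 on this neighborhood, too little to bridge the gap;
    -- only `j ≤ n` matter.
    refine ⟨⋂ j ∈ Finset.range (n + 1),
      (W j ∩ {z | |(n + 1) * s j z - (n + 1) * s j x| < 1 / 2}), ?_, ?_, ?_⟩
    · refine isOpen_biInter_finset fun j _ => (hWo j).inter (isOpen_lt ?_ continuous_const)
      have := hsc j
      fun_prop
    · simp only [mem_iInter]
      intro j _
      exact ⟨hxW j, by simp⟩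
    · have aux : ∀ i t j t' z z',
          (z ∈ ⋂ j ∈ Finset.range (n + 1),
            (W j ∩ {z | |(n + 1) * s j z - (n + 1) * s j x| < 1 / 2})) →
          (z' ∈ ⋂ j ∈ Finset.range (n + 1),
            (W j ∩ {z | |(n + 1) * s j z - (n + 1) * s j x| < 1 / 2})) →
          θ n (i, t) z ≠ 0 → θ n (j, t') z' ≠ 0 → ¬ i < j := by
        intro i t j t' z z' hz hz' h h' hij
        obtain ⟨k1, k2, k3, k4⟩ := key n i t z h
        obtain ⟨l1, l2, l3, l4⟩ := key n j t' z' h'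
        have e1' : |(n + 1) * s i z - (n + 1) * s i x| < 1 / 2 :=
          (mem_iInter₂.1 hz i (Finset.mem_range.2 (by omega))).2
        have e1 := abs_lt.1 e1'
        have e2' : |(n + 1) * s i z' - (n + 1) * s i x| < 1 / 2 :=
          (mem_iInter₂.1 hz' i (Finset.mem_range.2 (by omega))).2
        have e2 := abs_lt.1 e2'
        have := l4 i hij
        linarith [e1.1, e1.2, e2.1, e2.2]
      rintro ⟨j, t⟩ ⟨z, hz, h⟩ ⟨j', t'⟩ ⟨z', hz', h'⟩
      have hj : j = j' := le_antisymm (not_lt.1 (aux _ _ _ _ _ _ hz' hz h' h))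
        (not_lt.1 (aux _ _ _ _ _ _ hz hz' h h'))
      subst hj
      obtain ⟨k1, k2, -⟩ := key n j t z h
      obtain ⟨l1, l2, -⟩ := key n j t' z' h'
      rw [hWs j ⟨z, (mem_iInter₂.1 hz j (Finset.mem_range.2 (by omega))).1, k2⟩
        ⟨z', (mem_iInter₂.1 hz' j (Finset.mem_range.2 (by omega))).1, l2⟩]
  · have hex : ∃ j, s j x = 1 := by
      obtain ⟨j, t, h⟩ := hx
      exact ⟨j, by rw [hsu j t x (by rw [h]; exact one_ne_zero), h]⟩
    -- For the least such `j`, all earlier `s i x` are below 1, so their cut-off factors eventually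
    -- equal 1.
    set j := Nat.find hex with hj
    have hj1 : s j x = 1 := Nat.find_spec hex
    obtain ⟨t, ht⟩ : ∃ t, u j t x ≠ 0 := by
      by_contra h
      push Not at h
      simp [hs, h] at hj1
    have hut : u j t x = 1 := by rw [← hsu j t x ht, hj1]
    refine ⟨j, t, hut, ?_⟩
    have hev : ∀ i ∈ Finset.range j, ∀ᶠ n : ℕ in atTop, 3 ≤ ((n : ℝ) + 1) * (1 - s i x) := by
      intro i hi
      have h1 : 0 < 1 - s i x := by
        have := lt_of_le_of_ne (hs1 i x) (Nat.find_min hex (Finset.mem_range.1 hi))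
        linarith
      exact ((tendsto_natCast_atTop_atTop.atTop_add tendsto_const_nhds).atTop_mul_const
        h1).eventually_ge_atTop 3
    filter_upwards [eventually_ge_atTop j, (Finset.eventually_all _).2 hev] with n hn h
    simp only [hθ, if_pos hn, hut]
    rw [Finset.prod_eq_one]
    · simp
    · intro i hi
      rw [min_eq_left (by linarith [h i hi])]
      simp

/-- Over a path connected open set `V`, a map in `K₁ ∩ Σᶠ` admits bump functions subordinate to
preimages of small path connected open subsets of `V`. -/
theorem exists_bumps_over {Y : Type*} [MetricSpace Y] [LocallyPathConnectedSpace Y] {f : X → Y}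
    (hK : f ∈ FunctionalLebesgueOneClass X Y) (hS : f ∈ SigmaSFDClass X Y)
    {ε : ℝ} (hε : 0 < ε) {V : Set Y} (hV : IsOpen V) (hVc : IsPathConnected V) :
    ∃ (W : ℕ × Set X → Set Y) (θ : ℕ → ℕ × Set X → X → ℝ),
      (∀ c, IsOpen (W c) ∧ IsPathConnected (W c) ∧ W c ⊆ V) ∧
      (∀ n c, Continuous (θ n c)) ∧ (∀ n, DiscreteFamily fun c => {x | θ n c x ≠ 0}) ∧
      ∀ x, f x ∈ V → ∃ c, f x ∈ W c ∧ W c ⊆ Metric.ball (f x) ε ∧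
        ∀ᶠ n in atTop, θ n c x = 1 := by
  classical
  obtain ⟨B, ⟨A, rfl, hA⟩, hB⟩ := hS
  choose U hUd hUo hAU using hA
  choose b hbc hb0 hb1 hbU using fun n S => (hUo n S).exists_real
  -- sets of the base that are small over `V`
  set P : Set X → Set Y → Prop := fun S W => S ⊆ f ⁻¹' W ∧ IsOpen W ∧ IsPathConnected W ∧ W ⊆ V ∧
    ∀ y ∈ W, W ⊆ Metric.ball y ε with hP
  -- The default `V` is harmless: the bumps of such `S` are set to zero.
  set W : Set X → Set Y := fun S => if h : ∃ W, P S W then h.choose else V with hW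
  have hWP : ∀ S, (∃ W, P S W) → P S (W S) := by
    intro S h
    simp only [hW, dif_pos h]
    exact h.choose_spec
  have hWall : ∀ S, IsOpen (W S) ∧ IsPathConnected (W S) ∧ W S ⊆ V := by
    intro S
    by_cases h : ∃ W, P S W
    · exact ⟨(hWP S h).2.1, (hWP S h).2.2.1, (hWP S h).2.2.2.1⟩
    · simp only [hW, dif_neg h]
      exact ⟨hV, hVc, subset_rfl⟩
  choose F hF hFeq using fun S => hK (W S) (hWall S).1
  choose a hac ha0 ha1 haF using fun S k => (hF S k).exists_real
  -- the bump functions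
  let v : ℕ × ℕ × ℕ → Set X → X → ℝ := fun q S x =>
    if h : S ∈ A q.1 ∧ ∃ W, P S W then
      (1 - a S q.2.1 x) * min 1 (q.2.2 * b q.1 ⟨S, h.1⟩ x) else 0
  have hv : ∀ q S, Continuous (v q S) := by
    intro q S
    by_cases h : S ∈ A q.1 ∧ ∃ W, P S W
    · simp only [v, dif_pos h]
      have h1 := hac S q.2.1
      have h2 := hbc q.1 ⟨S, h.1⟩
      fun_prop
    · simp only [v, dif_neg h]
      exact continuous_const
  have hv1 : ∀ q S x, v q S x ≤ 1 := by
    intro q S x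
    by_cases h : S ∈ A q.1 ∧ ∃ W, P S W
    · simp only [v, dif_pos h]
      have := hb0 q.1 ⟨S, h.1⟩ x
      exact mul_le_one₀ (by linarith [ha0 S q.2.1 x]) (le_min zero_le_one (by positivity))
        (min_le_left _ _)
    · simp only [v, dif_neg h]
      exact zero_le_one
  have hvne : ∀ q S x, v q S x ≠ 0 → ∃ h : S ∈ A q.1, x ∈ U q.1 ⟨S, h⟩ := by
    intro q S x hx
    by_cases h : S ∈ A q.1 ∧ ∃ W, P S W
    · simp only [v, dif_pos h] at hx
      refine ⟨h.1, (hbU _ _ _).1 fun h0 => hx ?_⟩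
      simp [h0]
    · simp only [v, dif_neg h, ne_eq, not_true_eq_false] at hx
  have hvd : ∀ q, DiscreteFamily fun S => {x | v q S x ≠ 0} := by
    intro q x
    obtain ⟨O, hO, hxO, hOs⟩ := hUd q.1 x
    refine ⟨O, hO, hxO, ?_⟩
    rintro S ⟨z, hz, h⟩ S' ⟨z', hz', h'⟩
    obtain ⟨k, hk⟩ := hvne q S z h
    obtain ⟨k', hk'⟩ := hvne q S' z' h'
    exact congrArg Subtype.val (hOs ⟨z, hz, hk⟩ ⟨z', hz', hk'⟩)
  -- Both factors lie in `[0,1]`, so a product of 1 forces `a = 0`, that is, `x ∈ F S k`. This is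
  -- where `K₁` enters.
  have hvW : ∀ q S x, v q S x = 1 → f x ∈ W S ∧ W S ⊆ Metric.ball (f x) ε := by
    intro q S x hx
    by_cases h : S ∈ A q.1 ∧ ∃ W, P S W
    · simp only [v, dif_pos h] at hx
      have hm : min 1 ((q.2.2 : ℝ) * b q.1 ⟨S, h.1⟩ x) ≤ 1 := min_le_left _ _
      have hm0 : 0 ≤ min 1 ((q.2.2 : ℝ) * b q.1 ⟨S, h.1⟩ x) :=
        le_min zero_le_one (mul_nonneg (Nat.cast_nonneg _) (hb0 _ _ _))
      have h0 : a S q.2.1 x = 0 := by nlinarith [ha0 S q.2.1 x, ha1 S q.2.1 x]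
      have hfx : f x ∈ W S := by
        change x ∈ f ⁻¹' W S
        rw [hFeq S]
        exact mem_iUnion.2 ⟨_, (haF S q.2.1 x).1 h0⟩
      exact ⟨hfx, (hWP S h.2).2.2.2.2 _ hfx⟩
    · simp only [v, dif_neg h, zero_ne_one] at hx
  have hvex : ∀ x, f x ∈ V → ∃ q S, v q S x = 1 := by
    intro x hx
    obtain ⟨N, ⟨hNo, hxN, hNc⟩, hN⟩ := (isOpen_isPathConnected_basis (f x)).mem_iff.1
      ((hV.inter Metric.isOpen_ball).mem_nhds ⟨hx, Metric.mem_ball_self (half_pos hε)⟩)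
    obtain ⟨C, hC, hCN⟩ := hB N hNo
    obtain ⟨S, hSC, hxS⟩ := mem_sUnion.1 (show x ∈ ⋃₀ C from hCN ▸ hxN)
    obtain ⟨m, hm⟩ := mem_iUnion.1 (hC hSC)
    have hSP : ∃ W, P S W := by
      refine ⟨N, ?_, hNo, hNc, fun y hy => (hN hy).1, fun y hy z hz => ?_⟩
      · rw [hCN]
        exact subset_sUnion_of_mem hSC
      · have h1 := (hN hy).2
        have h2 := (hN hz).2
        rw [Metric.mem_ball] at *
        linarith [dist_triangle_right z y (f x)]
    have hxF : x ∈ ⋃ k, F S k := by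
      rw [← hFeq S]
      exact (hWP S hSP).1 hxS
    obtain ⟨k, hk⟩ := mem_iUnion.1 hxF
    have hb : 0 < b m ⟨S, hm⟩ x :=
      lt_of_le_of_ne (hb0 _ _ _) ((hbU _ _ _).2 (hAU m ⟨S, hm⟩ (subset_closure hxS))).symm
    obtain ⟨l, hl⟩ := exists_nat_gt (1 / b m ⟨S, hm⟩ x)
    refine ⟨(m, k, l), S, ?_⟩
    have h : S ∈ A m ∧ ∃ W, P S W := ⟨hm, hSP⟩
    simp only [v, dif_pos h]
    rw [(haF S k x).2 hk, min_eq_left]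
    · simp
    · rw [div_lt_iff₀ hb] at hl
      exact hl.le
  let e : ℕ ≃ ℕ × ℕ × ℕ := (Denumerable.eqv (ℕ × ℕ × ℕ)).symm
  obtain ⟨θ, h1, h2, h3⟩ := exists_disjointed_bumps (u := fun j S => v (e j) S)
    (fun j S => hv _ S) (fun j => hv1 _) (fun j => hvd _)
  refine ⟨fun c => W c.2, θ, fun c => hWall _, h1, h2, fun x hx => ?_⟩
  obtain ⟨q, S, hq⟩ := hvex x hx
  obtain ⟨j, t, hj, hjt⟩ := h3 x ⟨e.symm q, S, by rwa [e.apply_symm_apply]⟩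
  exact ⟨(j, t), (hvW _ _ _ hj).1, (hvW _ _ _ hj).2, hjt⟩

end Bumps

/-! ### Pointwise limits of continuous maps lie in both classes. -/

section Limits

variable {X Y : Type*} [TopologicalSpace X]

theorem functionallyClosed_setOf_eq_zero {a : X → ℝ} (ha : Continuous a) :
    FunctionallyClosed {x | a x = 0} := by
  refine ⟨fun x => ⟨min 1 |a x|, le_min zero_le_one (abs_nonneg _), min_le_left _ _⟩,
    by fun_prop, ?_⟩
  ext x
  constructor
  · intro h
    have h : a x = 0 := h
    exact Subtype.ext (by simp [h])
  · intro h
    have h : min 1 |a x| = 0 := congrArg Subtype.val h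
    rcases min_eq_iff.1 h with h | h
    · exact absurd h.1 one_ne_zero
    · exact abs_eq_zero.1 h.1

theorem FunctionallyClosed.preimage {Z : Type*} [TopologicalSpace Z] {A : Set Z}
    (hA : FunctionallyClosed A) {g : X → Z} (hg : Continuous g) :
    FunctionallyClosed (g ⁻¹' A) := by
  obtain ⟨φ, hφ, rfl⟩ := hA
  exact ⟨φ ∘ g, hφ.comp hg, rfl⟩

theorem FunctionallyOpen.preimage {Z : Type*} [TopologicalSpace Z] {A : Set Z}
    (hA : FunctionallyOpen A) {g : X → Z} (hg : Continuous g) : FunctionallyOpen (g ⁻¹' A) :=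
  FunctionallyClosed.preimage (A := Aᶜ) hA hg

theorem FunctionallyClosed.isClosed {A : Set X} (hA : FunctionallyClosed A) : IsClosed A := by
  obtain ⟨φ, hφ, rfl⟩ := hA
  exact isClosed_singleton.preimage hφ

theorem FunctionallyClosed.iInter {F : ℕ → Set X} (hF : ∀ n, FunctionallyClosed (F n)) :
    FunctionallyClosed (⋂ n, F n) := by
  choose a ha ha0 ha1 haF using fun n => (hF n).exists_real
  have hb : ∀ n x, ‖(1 / 2 : ℝ) ^ n * a n x‖ ≤ (1 / 2) ^ n := fun n x => by
    rw [Real.norm_of_nonneg (mul_nonneg (by positivity) (ha0 n x))]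
    exact mul_le_of_le_one_right (by positivity) (ha1 n x)
  convert functionallyClosed_setOf_eq_zero (a := fun x => ∑' n, (1 / 2 : ℝ) ^ n * a n x)
    (continuous_tsum (fun n => continuous_const.mul (ha n)) summable_geometric_two hb)
  ext x
  have hs : Summable fun n => (1 / 2 : ℝ) ^ n * a n x :=
    .of_norm_bounded summable_geometric_two fun n => hb n x
  have h0 := hs.hasSum_iff.symm.trans (hasSum_zero_iff_of_nonneg
    fun n => mul_nonneg (by positivity) (ha0 n x))
  rw [mem_iInter]
  refine Iff.trans ?_ h0.symm
  simp [funext_iff, haF]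

theorem IsClosed.functionallyClosed [MetricSpace Y] {C : Set Y} (hC : IsClosed C) :
    FunctionallyClosed C := by
  rcases C.eq_empty_or_nonempty with rfl | hne
  · convert functionallyClosed_setOf_eq_zero (X := Y) (a := fun _ => 1) continuous_const
    simp
  · convert functionallyClosed_setOf_eq_zero (Metric.continuous_infDist_pt C)
    ext x
    exact hC.mem_iff_infDist_zero hne

theorem functionallyClosed_forall_ge [MetricSpace Y] {g : ℕ → X → Y}
    (hg : ∀ n, Continuous (g n)) {C : Set Y} (hC : IsClosed C) (m : ℕ) :
    FunctionallyClosed {x | ∀ n ≥ m, g n x ∈ C} := by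
  convert FunctionallyClosed.iInter (F := fun n => g (n + m) ⁻¹' C)
    fun n => hC.functionallyClosed.preimage (hg _)
  ext x
  simp only [mem_iInter]
  exact ⟨fun h n => h _ (by omega), fun h n hn => by
    have := h (n - m)
    rwa [mem_preimage, Nat.sub_add_cancel hn] at this⟩

theorem lebesgueOne_of_baireOne [MetricSpace Y] {f : X → Y} (hf : f ∈ BaireOneClass X Y) :
    f ∈ FunctionalLebesgueOneClass X Y := by
  obtain ⟨g, hg, hlim⟩ := hf
  intro V hV
  -- Points at distance at least `1/(k+1)` from the complement of `V`.
  set C : ℕ → Set Y := fun k => (Metric.thickening (1 / ((k : ℝ) + 1)) Vᶜ)ᶜ with hCdef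
  have hC : ∀ k, IsClosed (C k) := fun k => Metric.isOpen_thickening.isClosed_compl
  have hCV : ∀ k, C k ⊆ V := fun k => compl_subset_comm.1
    (Metric.self_subset_thickening (by positivity) _)
  refine ⟨fun q => {x | ∀ n ≥ q.unpair.2, g n x ∈ C q.unpair.1},
    fun q => functionallyClosed_forall_ge hg (hC _) _, ?_⟩
  ext x
  rw [mem_iUnion]
  constructor
  · intro hx
    obtain ⟨ε, hε, hb⟩ := Metric.isOpen_iff.1 hV (f x) hx
    obtain ⟨k, hk⟩ := exists_nat_one_div_lt (half_pos hε)
    have hnear : ∀ y ∈ Metric.ball (f x) (ε / 2), y ∈ C k := by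
      intro y hy hyt
      obtain ⟨z, hz, hyz⟩ := Metric.mem_thickening_iff.1 hyt
      refine hz (hb ?_)
      rw [Metric.mem_ball] at *
      linarith [dist_triangle_left z (f x) y]
    obtain ⟨m, hm⟩ := eventually_atTop.1
      ((hlim x).eventually (Metric.ball_mem_nhds (f x) (half_pos hε)))
    refine ⟨Nat.pair k m, ?_⟩
    simp only [Nat.unpair_pair]
    exact fun n hn => hnear _ (hm n hn)
  · rintro ⟨q, hq⟩
    exact hCV _ ((hC _).mem_of_tendsto (hlim x) (eventually_atTop.2 ⟨_, hq⟩))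

/-- Points that are `δ`-deep in the ball of radius `r` around `s`, but outside the balls of the same
radius around smaller centers. -/
def stonePiece [MetricSpace Y] (r δ : ℝ) (s : Y) : Set Y :=
  {y | dist y s ≤ r - δ ∧ ∀ t, WellOrderingRel t s → r ≤ dist y t}

/-- If `t` precedes `s`, points of piece `s` are at least `r` from `t` and points of piece `t` at
most `r - δ`, so the pieces are `δ` apart. Two thickenings by `δ/4` and a ball of radius `δ/4` use
up less than `δ`. -/
theorem discreteFamily_thickening_stonePiece [MetricSpace Y] (r : ℝ) {δ : ℝ} (hδ : 0 < δ) :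
    DiscreteFamily fun s : Y => Metric.thickening (δ / 4) (stonePiece r δ s) := by
  intro z
  refine ⟨Metric.ball z (δ / 4), Metric.isOpen_ball, Metric.mem_ball_self (by positivity), ?_⟩
  have key : ∀ s t : Y,
      (Metric.ball z (δ / 4) ∩ Metric.thickening (δ / 4) (stonePiece r δ s)).Nonempty →
      (Metric.ball z (δ / 4) ∩ Metric.thickening (δ / 4) (stonePiece r δ t)).Nonempty →
      ¬ WellOrderingRel t s := by
    rintro s t ⟨p, hp, hps⟩ ⟨q, hq, hqt⟩ hts
    obtain ⟨a, ha, hpa⟩ := Metric.mem_thickening_iff.1 hps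
    obtain ⟨b, hb, hqb⟩ := Metric.mem_thickening_iff.1 hqt
    have h1 := ha.2 t hts
    have h2 := hb.1
    rw [Metric.mem_ball] at hp hq
    linarith [dist_triangle a p t, dist_triangle p z t, dist_triangle z q t, dist_triangle q b t,
      dist_comm a p, dist_comm z q]
  intro s hs t ht
  rcases trichotomous_of WellOrderingRel s t with h | h | h
  · exact absurd h (key t s ht hs)
  · exact h
  · exact absurd h (key s t hs ht)

/-- Take the first center `s` within `r` of `y` in the well-order. -/
theorem exists_mem_stonePiece [MetricSpace Y] {r : ℝ} (hr : 0 < r) (y : Y) :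
    ∃ s, ∃ k : ℕ, y ∈ stonePiece r (1 / (k + 1)) s := by
  have hne : {s : Y | dist y s < r}.Nonempty := ⟨y, by simpa using hr⟩
  have hwf : WellFounded (WellOrderingRel (α := Y)) := IsWellFounded.wf
  set s := hwf.min {s : Y | dist y s < r} hne with hs
  have hsr : dist y s < r := hwf.min_mem _ hne
  obtain ⟨k, hk⟩ := exists_nat_one_div_lt (sub_pos.2 hsr)
  exact ⟨s, k, by linarith, fun t ht => not_lt.1 fun h => hwf.not_lt_min _ h ht⟩

theorem sigma_of_baireOne [MetricSpace Y] {f : X → Y} (hf : f ∈ BaireOneClass X Y) :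
    f ∈ SigmaSFDClass X Y := by
  obtain ⟨g, hg, hlim⟩ := hf
  let e : ℕ ≃ ℕ × ℕ × ℕ := (Denumerable.eqv (ℕ × ℕ × ℕ)).symm
  let r : ℕ → ℝ := fun k => 1 / ((k : ℝ) + 1)
  have hr : ∀ k, 0 < r k := fun k => by positivity
  -- Closed, so that limits stay inside; a neighborhood of the piece, so that `g n x` eventually
  -- enters; inside the `r j / 4` thickening, so that discreteness survives.
  let C : ℕ → ℕ → Y → Set Y := fun k j s =>
    Metric.cthickening (r j / 8) (stonePiece (r k) (r j) s)
  have hCO : ∀ k j s, C k j s ⊆ Metric.thickening (r j / 4) (stonePiece (r k) (r j) s) :=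
    fun k j s => Metric.cthickening_subset_thickening' (by linarith [hr j]) (by linarith [hr j]) _
  have hCb : ∀ k j s, ∀ y ∈ C k j s, dist y s ≤ r k := by
    intro k j s y hy
    obtain ⟨a, ha, hya⟩ := Metric.mem_thickening_iff.1 (hCO k j s hy)
    linarith [dist_triangle y a s, ha.1, hr j]
  let D : ℕ × ℕ × ℕ → Y → Set X := fun q s => {x | ∀ n ≥ q.2.2, g n x ∈ C q.1 q.2.1 s}
  have hDcl : ∀ q s, FunctionallyClosed (D q s) := fun q s =>
    functionallyClosed_forall_ge hg Metric.isClosed_cthickening _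
  have hDf : ∀ q s x, x ∈ D q s → f x ∈ C q.1 q.2.1 s := fun q s x hx =>
    Metric.isClosed_cthickening.mem_of_tendsto (hlim x) (eventually_atTop.2 ⟨_, hx⟩)
  have hD : ∀ q, StronglyFunctionallyDiscrete (D q) := by
    intro q
    refine ⟨fun s => g q.2.2 ⁻¹' Metric.thickening (r q.2.1 / 4) (stonePiece (r q.1) (r q.2.1) s),
      fun x => ?_, fun s => ?_, fun s => ?_⟩
    · obtain ⟨O, hO, hx, hs⟩ := discreteFamily_thickening_stonePiece (r q.1) (hr q.2.1) (g q.2.2 x)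
      refine ⟨g q.2.2 ⁻¹' O, hO.preimage (hg _), hx, ?_⟩
      rintro s ⟨z, hz⟩ t ⟨z', hz'⟩
      exact hs ⟨_, hz⟩ ⟨_, hz'⟩
    · exact FunctionallyOpen.preimage
        (IsClosed.functionallyClosed Metric.isOpen_thickening.isClosed_compl) (hg _)
    · rw [(hDcl q s).isClosed.closure_eq]
      exact fun x hx => hCO _ _ _ (hx _ le_rfl)
  refine ⟨⋃ n, range (D (e n)), ⟨fun n => range (D (e n)), rfl, fun n => (hD _).range⟩,
    fun V hV => ⟨{S | S ∈ ⋃ n, range (D (e n)) ∧ S ⊆ f ⁻¹' V}, fun S hS => hS.1, ?_⟩⟩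
  refine Subset.antisymm (fun x hx => ?_) (sUnion_subset fun S hS => hS.2)
  obtain ⟨ε, hε, hb⟩ := Metric.isOpen_iff.1 hV (f x) hx
  obtain ⟨k, hk⟩ := exists_nat_one_div_lt (half_pos hε)
  obtain ⟨s, j, hs⟩ := exists_mem_stonePiece (hr k) (f x)
  obtain ⟨m, hm⟩ := eventually_atTop.1 ((hlim x).eventually
    (Metric.isOpen_thickening.mem_nhds (Metric.self_subset_thickening
      (by linarith [hr j] : 0 < r j / 8) _ hs)))
  have hxD : x ∈ D (k, j, m) s := fun n hn => Metric.thickening_subset_cthickening _ _ (hm n hn)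
  refine mem_sUnion.2 ⟨D (k, j, m) s, ⟨mem_iUnion.2 ⟨e.symm (k, j, m), s, ?_⟩, fun z hz => hb ?_⟩,
    hxD⟩
  · rw [e.apply_symm_apply]
  · have h1 := hCb _ _ _ _ (hDf _ _ _ hz)
    have h2 := hCb _ _ _ _ (hDf _ _ _ hxD)
    have h3 : r k < ε / 2 := hk
    rw [Metric.mem_ball]
    linarith [dist_triangle_right (f z) (f x) s]

end Limits

/-! ### The refinement tree, and convergence of the approximations. -/

section Tower

variable {X Y ι : Type*}

/-- The sets at the nodes of a tree built by iterating a refinement operation. -/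
def treeSet (W : ℕ → Set Y → ι → Set Y) : List ι → Set Y
  | [] => univ
  | c :: l => W l.length (treeSet W l) c

/-- The bump functions at the nodes of a tree built by iterating a refinement operation. -/
noncomputable def treeBump (W : ℕ → Set Y → ι → Set Y) (θ : ℕ → Set Y → ι → X → ℝ) :
    List ι → X → ℝ
  | [] => 1
  | c :: l => fun x => θ l.length (treeSet W l) c x * max 0 (2 * treeBump W θ l x - 1)

theorem treeBump_cons_ne_zero {W : ℕ → Set Y → ι → Set Y} {θ : ℕ → Set Y → ι → X → ℝ}
    {c : ι} {l : List ι} {x : X} (h : treeBump W θ (c :: l) x ≠ 0) :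
    θ l.length (treeSet W l) c x ≠ 0 ∧ 1 / 2 ≤ treeBump W θ l x := by
  refine ⟨left_ne_zero_of_mul h, ?_⟩
  have := right_ne_zero_of_mul h
  by_contra h'
  exact this (max_eq_left (by linarith [not_le.1 h']))

theorem continuous_treeBump [TopologicalSpace X] {W : ℕ → Set Y → ι → Set Y}
    {θ : ℕ → Set Y → ι → X → ℝ}
    (hθ : ∀ p l c, Continuous (θ p (treeSet W l) c)) (l : List ι) :
    Continuous (treeBump W θ l) := by
  induction l with
  | nil => exact continuous_const
  | cons c l ih =>
    have := hθ l.length l c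
    simp only [treeBump]
    fun_prop

/-- Near a point one node of level `p` is active, so the active nodes of level `p + 1` are its
children, and these are discrete. -/
theorem discreteFamily_treeBump [TopologicalSpace X] {W : ℕ → Set Y → ι → Set Y}
    {θ : ℕ → Set Y → ι → X → ℝ}
    (hθ : ∀ p l, DiscreteFamily fun c => {x | θ p (treeSet W l) c x ≠ 0}) (p : ℕ) :
    DiscreteFamily fun l : {l : List ι // l.length = p} => {x | treeBump W θ l x ≠ 0} := by
  induction p with
  | zero =>
    exact fun x => ⟨univ, isOpen_univ, mem_univ x, fun l _ l' _ => Subtype.ext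
      ((List.length_eq_zero_iff.1 l.2).trans (List.length_eq_zero_iff.1 l'.2).symm)⟩
  | succ p ih =>
    intro x
    obtain ⟨O, hO, hxO, hOs⟩ := ih x
    have step : ∀ c (l : List ι) z, treeBump W θ (c :: l) z ≠ 0 → treeBump W θ l z ≠ 0 := by
      intro c l z h h0
      have := (treeBump_cons_ne_zero h).2
      norm_num [h0] at this
    by_cases hne : ∃ l : {l : List ι // l.length = p}, (O ∩ {x | treeBump W θ l x ≠ 0}).Nonempty
    · obtain ⟨l, hl⟩ := hne
      obtain ⟨O', hO', hxO', hOs'⟩ := hθ p l.1 x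
      refine ⟨O ∩ O', hO.inter hO', ⟨hxO, hxO'⟩, ?_⟩
      have key : ∀ l' : {l : List ι // l.length = p + 1}, ∀ z ∈ O ∩ O', treeBump W θ l'.1 z ≠ 0 →
          ∃ c, l'.1 = c :: l.1 ∧ θ p (treeSet W l.1) c z ≠ 0 := by
        rintro ⟨l', hl'⟩ z hz h
        cases l' with
        | nil => simp at hl'
        | cons c l' =>
          have hlen : l'.length = p := by simpa using hl'
          have e : (⟨l', hlen⟩ : {l : List ι // l.length = p}) = l :=
            hOs ⟨z, hz.1, step _ _ _ h⟩ hl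
          subst e
          have := (treeBump_cons_ne_zero h).1
          rw [hlen] at this
          exact ⟨c, rfl, this⟩
      rintro l₁ ⟨z, hz, h⟩ l₂ ⟨z', hz', h'⟩
      obtain ⟨c, hc, hcz⟩ := key l₁ z hz h
      obtain ⟨c', hc', hcz'⟩ := key l₂ z' hz' h'
      have : c = c' := hOs' ⟨z, hz.2, hcz⟩ ⟨z', hz'.2, hcz'⟩
      exact Subtype.ext (by rw [hc, hc', this])
    · refine ⟨O, hO, hxO, ?_⟩
      rintro ⟨l', hl'⟩ ⟨z, hz, h⟩
      cases l' with
      | nil => simp at hl'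
      | cons c l' => exact absurd ⟨⟨l', by simpa using hl'⟩, z, hz, step _ _ _ h⟩ hne

theorem baireOne_of_lebesgueOne_of_sigma {X Y : Type*} [TopologicalSpace X] [MetricSpace Y]
    [PathConnectedSpace Y] [LocallyPathConnectedSpace Y] {f : X → Y}
    (hK : f ∈ FunctionalLebesgueOneClass X Y) (hS : f ∈ SigmaSFDClass X Y) :
    f ∈ BaireOneClass X Y := by
  have H : ∀ (k : ℕ) (V : Set Y), ∃ (W : ℕ × Set X → Set Y) (θ : ℕ → ℕ × Set X → X → ℝ),
      IsOpen V ∧ IsPathConnected V →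
      (∀ c, IsOpen (W c) ∧ IsPathConnected (W c) ∧ W c ⊆ V) ∧
      (∀ n c, Continuous (θ n c)) ∧ (∀ n, DiscreteFamily fun c => {x | θ n c x ≠ 0}) ∧
      ∀ x, f x ∈ V → ∃ c, f x ∈ W c ∧ W c ⊆ Metric.ball (f x) (1 / (k + 1)) ∧
        ∀ᶠ n in atTop, θ n c x = 1 := by
    intro k V
    by_cases hV : IsOpen V ∧ IsPathConnected V
    · obtain ⟨W, θ, h⟩ := exists_bumps_over hK hS
        (by positivity : (0 : ℝ) < 1 / (k + 1)) hV.1 hV.2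
      exact ⟨W, θ, fun _ => h⟩
    -- Junk values make the refinement total; the tree only meets path connected open sets.
    · exact ⟨fun _ => ∅, fun _ _ _ => 0, fun h => absurd h hV⟩
  choose W θ hWθ using H
  have hV : ∀ l, IsOpen (treeSet W l) ∧ IsPathConnected (treeSet W l) := by
    intro l
    induction l with
    | nil => exact ⟨isOpen_univ, isPathConnected_univ⟩
    | cons c l ih =>
      have := (hWθ l.length _ ih).1 c
      exact ⟨this.1, this.2.1⟩
  -- A diagonal choice: `n` is both the index of the bumps and the depth of the tower. The sets of
  -- the tree do not depend on `n`.
  have hg := fun n => exists_continuous_of_tower (V := treeSet W)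
    (φ := treeBump W fun k V => θ k V n) (fun l => (hV l).2)
    (fun c l => ((hWθ l.length _ (hV l)).1 c).2.2)
    (continuous_treeBump fun p l => (hWθ p _ (hV l)).2.1 n)
    (fun c l x h => (treeBump_cons_ne_zero h).2)
    (discreteFamily_treeBump fun p l => (hWθ p _ (hV l)).2.2.1 n) n
  choose g hgc hgV using hg
  refine ⟨g, hgc, fun x => ?_⟩
  have hbranch : ∀ p : ℕ, ∃ l : List (ℕ × Set X), l.length = p ∧ f x ∈ treeSet W l ∧
      (∀ᶠ n in atTop, treeBump W (fun k V => θ k V n) l x = 1) ∧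
      (p ≠ 0 → treeSet W l ⊆ Metric.ball (f x) (1 / p)) := by
    intro p
    induction p with
    | zero => exact ⟨[], rfl, mem_univ _, Eventually.of_forall fun _ => rfl, fun h => absurd rfl h⟩
    | succ p ih =>
      obtain ⟨l, hl, hxl, hn, -⟩ := ih
      obtain ⟨c, hc, hcb, hcn⟩ := (hWθ l.length _ (hV l)).2.2.2 x hxl
      refine ⟨c :: l, by simp [hl], hc, ?_, fun _ => ?_⟩
      · filter_upwards [hn, hcn] with n h1 h2
        simp only [treeBump, h1, h2]
        norm_num
      · rw [hl] at hcb
        simpa [treeSet, hl] using hcb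
  rw [Metric.tendsto_nhds]
  intro ε hε
  obtain ⟨p, hp⟩ := exists_nat_one_div_lt hε
  obtain ⟨l, hl, -, hn, hb⟩ := hbranch (p + 1)
  filter_upwards [hn, eventually_ge_atTop (p + 1)] with n h1 h2
  have := hb p.succ_ne_zero (hgV n l x (by omega) (by rw [h1]; norm_num))
  rw [Metric.mem_ball] at this
  push_cast at this
  linarith

end Tower
theorem mainTheorem1 {X Y : Type*} [TopologicalSpace X] [TopologicalSpace Y]
    [TopologicalSpace.MetrizableSpace Y] [PreconnectedSpace Y] [LocallyPathConnectedSpace Y] :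
    BaireOneClass X Y = FunctionalLebesgueOneClass X Y ∩ SigmaSFDClass X Y := by
  let := TopologicalSpace.metrizableSpaceMetric Y
  refine Subset.antisymm
    (fun f hf => ⟨lebesgueOne_of_baireOne hf, sigma_of_baireOne hf⟩) fun f hf => ?_
  -- `Y` may be empty; a point of `X` supplies, through `f`, the point needed for path
  -- connectedness.
  rcases isEmpty_or_nonempty X with hX | ⟨⟨x⟩⟩
  · exact ⟨fun _ => f, fun _ => continuous_iff_continuousAt.2 fun x => isEmptyElim x,
      fun x => isEmptyElim x⟩
  · have : ConnectedSpace Y := { toNonempty := ⟨f x⟩ }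
    have : PathConnectedSpace Y := pathConnectedSpace_iff_connectedSpace.2 inferInstance
    exact baireOne_of_lebesgueOne_of_sigma hf.1 hf.2
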